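/- Let $H$ be a separable real Hilbert space and let $X$ be a random variable with values in $H$ such that (A1) for every $h\in H$ there is $h'\in H$ with $\langle h,h'\rangle=0$ and $\mathrm{Var}(\langle h',X\rangle)>0$ (the variance being $+\infty$ when $\langle h',X\rangle$ is not square integrable); (A2) there is a constant $C>0$ with $\mathbb{E}[\|X-h\|^{-1}]\le C$ for all $h\in H$; (A3) there is a constant $C>0$ with $\mathbb{E}[\|X-h\|^{-2}]\le C$ for all $h\in H$. Let $m$ be the geometric median of $X$, that is, the minimizer over $h\in H$ of $\mathbb{E}[\|X-h\|-\|X\|]$. Let $X_1,X_2,\dots$ be i.i.d. copies of $X$, and let $Z_1$ be an almost surely bounded $H$-valued random variable that is independent of $(X_2,X_3,\dots)$ (for example a bounded measurable function of $X_1$). For $n\ge 1$ define $$Z_{n+1}=Z_n+\gamma_n\frac{X_{n+1}-Z_n}{\|X_{n+1}-Z_n\|},\qquad \gamma_n=c_\gamma n^{-\alpha},$$ where $c_\gamma>0$ and $\alpha\in(1/2,1)$ (the fraction is read as $0$ on the null event $X_{n+1}=Z_n$). Then $\mathbb{E}\|Z_n-m\|^2$ and $\mathbb{E}\|Z_n-m\|^4$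 are finite for every $n\ge 1$, $Z_n$ converges to $m$ in quadratic mean, and, as $n\to\infty$, $$\mathbb{E}\left[\|Z_n-m\|^2\right]=O\left(\frac1{n^{\alpha}}\right),\qquad \mathbb{E}\left[\|Z_n-m\|^4\right]=O\left(\frac1{n^{\beta}}\right)\quad\text{for every }\beta\in(\alpha,3\alpha-1).$$ -/

import Mathlib

open MeasureTheory ProbabilityTheory Filter Asymptotics
open scoped Topology ENNReal

namespace GeomMedian

variable {Ω H : Type*} [MeasurableSpace Ω] [NormedAddCommGroup H] [InnerProductSpace ℝ H]

/-- The objective `G(h) = 𝔼[‖X - h‖ - ‖X‖]`; the integrand is bounded by `‖h‖`, so it is integrable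
for every random variable `X` and no moment of `X` is needed. -/
noncomputable def objective (X : Ω → H) (μ : Measure Ω) (h : H) : ℝ :=
  ∫ ω, (‖X ω - h‖ - ‖X ω‖) ∂μ

/-- `m` is a geometric median of `X`: it minimizes `G` over the whole space. -/
def IsGeometricMedian (X : Ω → H) (μ : Measure Ω) (m : H) : Prop :=
  IsMinOn (objective X μ) Set.univ m

/-- `X` is not concentrated on a straight line: for every `h` there is `h'` orthogonal to `h` with
`Var ⟨h', X⟩ > 0`. The variance takes values in `[0, ∞]` and is `∞` when `⟨h', X⟩` is not
square integrable, since no moment of `X` is assumed. -/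
def NotOnLine (X : Ω → H) (μ : Measure Ω) : Prop :=
  ∀ h : H, ∃ h' : H, inner ℝ h h' = 0 ∧ 0 < evariance (fun ω => (inner ℝ h' (X ω) : ℝ)) μ

/-- `sup_h 𝔼[‖X - h‖⁻¹] < ∞`, where the integrand is `∞` at the points with `X = h`. -/
def InvMomentBounded (X : Ω → H) (μ : Measure Ω) : Prop :=
  ∃ C : ℝ, 0 < C ∧ ∀ h : H, ∫⁻ ω, (‖X ω - h‖ₑ)⁻¹ ∂μ ≤ ENNReal.ofReal C

/-- `sup_h 𝔼[‖X - h‖⁻²] < ∞`, where the integrand is `∞` at the points with `X = h`. -/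
def InvSqMomentBounded (X : Ω → H) (μ : Measure Ω) : Prop :=
  ∃ C : ℝ, 0 < C ∧ ∀ h : H, ∫⁻ ω, (‖X ω - h‖ₑ ^ 2)⁻¹ ∂μ ≤ ENNReal.ofReal C

/-- The Robbins–Monro iterates `Z₁, Z₂, …`, with
`Z_{n+1} = Z_n + γ_n (X_{n+1} - Z_n) / ‖X_{n+1} - Z_n‖` for `n ≥ 1` (the increment is `0` if
`X_{n+1} = Z_n`). The index `0` is not used by the algorithm; the value there is a placeholder. -/
noncomputable def iterate (γ : ℕ → ℝ) (Z₁ : Ω → H) (X : ℕ → Ω → H) : ℕ → Ω → H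
  | 0 => Z₁
  | 1 => Z₁
  | n + 2 => fun ω =>
      iterate γ Z₁ X (n + 1) ω +
        (γ (n + 1) / ‖X (n + 2) ω - iterate γ Z₁ X (n + 1) ω‖) •
          (X (n + 2) ω - iterate γ Z₁ X (n + 1) ω)

/-- The steps `γ_n = c n^{-α}`. -/
noncomputable def stepSize (c α : ℝ) (n : ℕ) : ℝ := c * (n : ℝ) ^ (-α)

end GeomMedian

/-! The proof rests on one growth estimate: `G(h) - G(m) ≥ κ min(‖h-m‖², ‖h-m‖)`
(`IsGeometricMedian.exists_growth`). Near `m` it comes from integrating a second-order lower bound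
for the norm. The linear term has a favourable sign because `m` is a minimizer, and the quadratic
term is bounded below uniformly over the unit sphere. As that sphere need not be compact, uniformity
comes from averaging over two independent directions of `X - m` (`exists_le_integral_curvature`).
Far from `m`, convexity turns the bound at distance 1 into linear growth.

Put `D_n = ‖Z_n - m‖` and `δ_n = ‖X_{n+1} - m‖ - ‖X_{n+1} - Z_n‖`. The subgradient inequality for
the norm gives `D_{n+1}² ≤ D_n² + 2γ_n δ_n + γ_n²`, and by independence the mean of `δ_n` given
`Z_n` is `G(m) - G(Z_n) ≤ -κ min(D_n², D_n)`. `IsContractive` records exactly this, and the rest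
concerns real processes only.

The obstacle is that the drift is `min(D², D)` rather than `D²`. Since `∑ γ_n²` converges, all
moments of `D_n` are bounded in `n` (`exists_integral_pow_le`), so truncating at level `n^ε`
replaces the minimum by `n^{-ε} D²` up to `O(n^{-2})`. The recursions then give `E D_n² =
O(n^{-(α-ε)})` and, with this inserted, `E D_n⁴ = O(n^{-β})` for every `β < 2α`. Finally `D² ≤
min(D², D) + D⁴`, with the fourth moment now `O(n^{-α})`, removes the loss `ε` from the second
moment. -/

namespace GeomMedian

/-! ### Pointwise inequalities for the norm of a real inner product space. -/

section Pointwise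

variable {H : Type*} [NormedAddCommGroup H] [InnerProductSpace ℝ H]

theorem norm_sub_le_quadratic {y : H} (hy : y ≠ 0) (u : H) :
    ‖y - u‖ - ‖y‖ ≤ -inner ℝ (‖y‖⁻¹ • y) u + ‖u‖ ^ 2 / 2 * ‖y‖⁻¹ := by
  have hy' : 0 < ‖y‖ := norm_pos_iff.2 hy
  have h := norm_sub_sq_real y u
  rw [real_inner_smul_left]
  have h2 : (‖y - u‖ - ‖y‖) ^ 2 ≥ 0 := sq_nonneg _
  have h3 : (‖y - u‖ - ‖y‖) * ‖y‖ ≤ -inner ℝ y u + ‖u‖ ^ 2 / 2 := by nlinarith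
  calc ‖y - u‖ - ‖y‖ = ((‖y - u‖ - ‖y‖) * ‖y‖) * ‖y‖⁻¹ := by field_simp
    _ ≤ (-inner ℝ y u + ‖u‖ ^ 2 / 2) * ‖y‖⁻¹ := by gcongr
    _ = _ := by ring

/-- With `s` the component of `u` along `y`, the product `(‖y-u‖ - (‖y‖-s)) (‖y-u‖ + (‖y‖-s))`
equals `‖u‖² - s²`, and its second factor is at most `2(‖y‖+1)` because `‖u‖ ≤ 1`. -/
theorem quadratic_le_norm_sub {y : H} (hy : y ≠ 0) {u : H} (hu : ‖u‖ ≤ 1) :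
    -inner ℝ (‖y‖⁻¹ • y) u
        + (‖y‖ + 1)⁻¹ * (‖u‖ ^ 2 - inner ℝ (‖y‖⁻¹ • y) u ^ 2) / 2 ≤ ‖y - u‖ - ‖y‖ := by
  have hy' : 0 < ‖y‖ := norm_pos_iff.2 hy
  have h := norm_sub_sq_real y u
  set s : ℝ := inner ℝ (‖y‖⁻¹ • y) u with hs
  have hsy : inner ℝ y u = ‖y‖ * s := by
    rw [hs, real_inner_smul_left]; field_simp
  have hn : ‖‖y‖⁻¹ • y‖ = 1 := by
    rw [norm_smul, norm_inv, norm_norm]; field_simp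
  have hsabs : |s| ≤ ‖u‖ := by
    have := abs_real_inner_le_norm (‖y‖⁻¹ • y) u
    rwa [hn, one_mul] at this
  have hr : 0 ≤ ‖u‖ ^ 2 - s ^ 2 := by
    have := sq_le_sq' (abs_le.1 hsabs).1 (abs_le.1 hsabs).2
    linarith
  have hid : (‖y - u‖ - (‖y‖ - s)) * (‖y - u‖ + (‖y‖ - s)) = ‖u‖ ^ 2 - s ^ 2 := by
    rw [hsy] at h; nlinarith
  have hle : ‖y - u‖ + (‖y‖ - s) ≤ 2 * (‖y‖ + 1) := by
    have := norm_sub_le y u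
    have := (abs_le.1 hsabs).1
    linarith
  have hpos : 0 ≤ ‖y - u‖ - (‖y‖ - s) := by
    have h3 : (‖y‖ - s) ^ 2 ≤ ‖y - u‖ ^ 2 := by nlinarith
    have := abs_le_of_sq_le_sq' h3 (norm_nonneg _)
    linarith
  have key : ‖u‖ ^ 2 - s ^ 2 ≤ (‖y - u‖ - (‖y‖ - s)) * (2 * (‖y‖ + 1)) := by
    rw [← hid]; gcongr
  have h1 : 0 < ‖y‖ + 1 := by linarith
  have : (‖y‖ + 1)⁻¹ * (‖u‖ ^ 2 - s ^ 2) / 2 ≤ ‖y - u‖ - (‖y‖ - s) := by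
    rw [inv_mul_eq_div, div_div, div_le_iff₀ (by positivity)]
    linarith
  linarith

/-- These are squared sines of angles between lines. The distance from `p` to the line of `q` is at
most the distance to `(a * b) • q`, which the triangle inequality through `a • e` bounds by the sum
of the other two sines. -/
theorem one_sub_inner_sq_le {p q e : H} (hp : ‖p‖ = 1) (hq : ‖q‖ = 1) (he : ‖e‖ = 1) :
    1 - inner ℝ q p ^ 2 ≤ 2 * (1 - inner ℝ p e ^ 2) + 2 * (1 - inner ℝ q e ^ 2) := by
  set a : ℝ := inner ℝ p e with ha
  set b : ℝ := inner ℝ q e with hb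
  have hx : ‖p - a • e‖ ^ 2 = 1 - a ^ 2 := by
    rw [norm_sub_sq_real, real_inner_smul_right, norm_smul, hp, he, ← ha, Real.norm_eq_abs,
      mul_one, sq_abs]
    ring
  have hy : ‖e - b • q‖ ^ 2 = 1 - b ^ 2 := by
    rw [norm_sub_sq_real, real_inner_smul_right, norm_smul, hq, he, real_inner_comm, ← hb,
      Real.norm_eq_abs, mul_one, sq_abs]
    ring
  have hz : ‖p - (a * b) • q‖ ^ 2 = 1 - 2 * (a * b * inner ℝ q p) + (a * b) ^ 2 := by
    rw [norm_sub_sq_real, real_inner_smul_right, norm_smul, hp, hq, real_inner_comm,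
      Real.norm_eq_abs, mul_one, sq_abs]
    ring
  have ht : ‖p - (a * b) • q‖ ≤ ‖p - a • e‖ + |a| * ‖e - b • q‖ := by
    have : p - (a * b) • q = (p - a • e) + a • (e - b • q) := by
      rw [smul_sub, smul_smul]; abel
    rw [this]
    refine (norm_add_le _ _).trans ?_
    rw [norm_smul, Real.norm_eq_abs]
  have ha1 : |a| ≤ 1 := by
    have := abs_real_inner_le_norm p e
    rwa [hp, he, one_mul] at this
  have ht' : ‖p - (a * b) • q‖ ≤ ‖p - a • e‖ + ‖e - b • q‖ := by
    have := mul_le_of_le_one_left (norm_nonneg (e - b • q)) ha1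
    linarith
  have h1 : ‖p - (a * b) • q‖ ^ 2 ≤ (‖p - a • e‖ + ‖e - b • q‖) ^ 2 := by gcongr
  nlinarith [sq_nonneg (inner ℝ q p - a * b), sq_nonneg (‖p - a • e‖ - ‖e - b • q‖)]

/-- The subgradient inequality at `z` for the convex function `‖x - ·‖`; it converts the algorithm's
step into a difference of objective integrands. -/
theorem inner_le_norm_sub_norm (m x z : H) :
    inner ℝ (z - m) (‖x - z‖⁻¹ • (x - z)) ≤ ‖x - m‖ - ‖x - z‖ := by
  rcases eq_or_ne x z with rfl | hne
  · simp
  · have hpos : 0 < ‖x - z‖ := norm_pos_iff.2 (sub_ne_zero.2 hne)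
    have h1 : inner ℝ (z - m) (x - z) = inner ℝ (x - m) (x - z) - ‖x - z‖ ^ 2 := by
      rw [← real_inner_self_eq_norm_sq, ← inner_sub_left]; congr 1; abel
    have h2 := real_inner_le_norm (x - m) (x - z)
    rw [real_inner_smul_right, inv_mul_le_iff₀ hpos, h1]
    nlinarith

theorem abs_norm_sub_sub_norm_sub_le {H : Type*} [NormedAddCommGroup H] (m x z : H) : |‖x - m‖ - ‖x - z‖| ≤ ‖z - m‖ := by
  refine (abs_norm_sub_norm_le _ _).trans (le_of_eq ?_)
  congr 1; abel

theorem norm_step_sq_le {γ : ℝ} (hγ : 0 ≤ γ) (m x z : H) :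
    ‖z + (γ / ‖x - z‖) • (x - z) - m‖ ^ 2
      ≤ ‖z - m‖ ^ 2 + 2 * γ * (‖x - m‖ - ‖x - z‖) + γ ^ 2 := by
  have h0 : z + (γ / ‖x - z‖) • (x - z) - m = (z - m) + γ • (‖x - z‖⁻¹ • (x - z)) := by
    rw [smul_smul, div_eq_mul_inv]; abel
  have hU : ‖‖x - z‖⁻¹ • (x - z)‖ ≤ 1 := by
    rw [norm_smul, norm_inv, norm_norm]
    exact inv_mul_le_one
  have h1 := inner_le_norm_sub_norm m x z
  rw [h0, norm_add_sq_real, real_inner_smul_right, norm_smul, Real.norm_eq_abs, abs_of_nonneg hγ]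
  have h2 : (γ * ‖‖x - z‖⁻¹ • (x - z)‖) ^ 2 ≤ γ ^ 2 := by
    have : γ * ‖‖x - z‖⁻¹ • (x - z)‖ ≤ γ := mul_le_of_le_one_right hγ hU
    gcongr
  nlinarith [mul_le_mul_of_nonneg_left h1 hγ]

end Pointwise

/-! ### Directions from the median and the curvature integrand. -/

section Direction

variable {Ω H : Type*} [NormedAddCommGroup H] [InnerProductSpace ℝ H] {X : Ω → H} {m : H}

/-- The direction of `X` seen from `m`. -/
noncomputable def direction (X : Ω → H) (m : H) (ω : Ω) : H := ‖X ω - m‖⁻¹ • (X ω - m)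

theorem norm_direction_le (ω : Ω) : ‖direction X m ω‖ ≤ 1 := by
  rw [direction, norm_smul, norm_inv, norm_norm]
  exact inv_mul_le_one

theorem norm_direction {ω : Ω} (hω : X ω ≠ m) : ‖direction X m ω‖ = 1 := by
  have : ‖X ω - m‖ ≠ 0 := by simpa [sub_eq_zero] using hω
  rw [direction, norm_smul, norm_inv, norm_norm, inv_mul_cancel₀ this]

theorem abs_inner_direction_le (ω : Ω) (u : H) : |inner ℝ (direction X m ω) u| ≤ ‖u‖ := by
  refine (abs_real_inner_le_norm _ _).trans ?_
  exact mul_le_of_le_one_left (norm_nonneg _) (norm_direction_le ω)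

/-- The integrand controlling the curvature of the objective at `m` in the direction `e`. -/
noncomputable def curvature (X : Ω → H) (m : H) (e : H) (ω : Ω) : ℝ :=
  (‖X ω - m‖ + 1)⁻¹ * (1 - inner ℝ (direction X m ω) e ^ 2)

theorem one_sub_inner_direction_sq_nonneg {e : H} (he : ‖e‖ ≤ 1) (ω : Ω) :
    0 ≤ 1 - inner ℝ (direction X m ω) e ^ 2 := by
  have h := (abs_inner_direction_le (X := X) (m := m) ω e).trans he
  have := (sq_le_one_iff_abs_le_one _).2 h
  linarith

theorem weight_le_one {H : Type*} [NormedAddCommGroup H] {X : Ω → H} {m : H} (ω : Ω) : (‖X ω - m‖ + 1)⁻¹ ≤ 1 :=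
  inv_le_one_of_one_le₀ (by linarith [norm_nonneg (X ω - m)])

theorem curvature_nonneg {e : H} (he : ‖e‖ ≤ 1) (ω : Ω) : 0 ≤ curvature X m e ω :=
  mul_nonneg (by positivity) (one_sub_inner_direction_sq_nonneg he ω)

theorem curvature_le_one {e : H} (he : ‖e‖ ≤ 1) (ω : Ω) : curvature X m e ω ≤ 1 :=
  mul_le_one₀ (weight_le_one ω) (one_sub_inner_direction_sq_nonneg he ω)
    (by linarith [sq_nonneg (inner ℝ (direction X m ω) e : ℝ)])

end Direction

/-! ### Consequences of the inverse moment bound; differences of the objective. -/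

section Integrability

variable {Ω H : Type*} [MeasurableSpace Ω] [NormedAddCommGroup H] [MeasurableSpace H]
  [BorelSpace H] [SecondCountableTopology H] {X : Ω → H} {μ : Measure Ω}

/-- The extended integrand is `∞` where `X = h`, so a finite integral excludes atoms. -/
theorem InvMomentBounded.ae_ne (hA2 : InvMomentBounded X μ) (hX : Measurable X) (h : H) :
    ∀ᵐ ω ∂μ, X ω ≠ h := by
  obtain ⟨C, -, hC⟩ := hA2
  have := ae_lt_top (f := fun ω => (‖X ω - h‖ₑ)⁻¹) (μ := μ) (by fun_prop)
    ((hC h).trans_lt ENNReal.ofReal_lt_top).ne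
  filter_upwards [this] with ω hω heq
  simp [heq] at hω

theorem InvMomentBounded.integrable_inv_norm (hA2 : InvMomentBounded X μ) (hX : Measurable X)
    (h : H) : Integrable (fun ω => ‖X ω - h‖⁻¹) μ := by
  have hne := hA2.ae_ne hX h
  obtain ⟨C, -, hC⟩ := hA2
  refine ⟨by fun_prop, ?_⟩
  refine lt_of_le_of_lt ?_ ((hC h).trans_lt ENNReal.ofReal_lt_top)
  refine lintegral_mono_ae ?_
  filter_upwards [hne] with ω hω
  rw [enorm_inv (by simpa [sub_eq_zero] using hω)]
  simp

theorem integrable_norm_sub_sub [IsFiniteMeasure μ] (hX : Measurable X) (h k : H) :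
    Integrable (fun ω => ‖X ω - h‖ - ‖X ω - k‖) μ := by
  refine Integrable.of_bound (by fun_prop) ‖k - h‖ (ae_of_all _ fun ω => ?_)
  exact abs_norm_sub_sub_norm_sub_le h (X ω) k

theorem objective_sub_objective [IsFiniteMeasure μ] (hX : Measurable X) (h k : H) :
    objective X μ h - objective X μ k = ∫ ω, (‖X ω - h‖ - ‖X ω - k‖) ∂μ := by
  have h0 : ∀ h, Integrable (fun ω => ‖X ω - h‖ - ‖X ω‖) μ := fun h => by
    simpa using integrable_norm_sub_sub (μ := μ) hX h 0
  rw [objective, objective, ← integral_sub (h0 h) (h0 k)]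
  congr 1; ext ω; ring

end Integrability

/-! ### Growth of the objective away from the median. -/

section Growth

variable {Ω H : Type*} [MeasurableSpace Ω] [NormedAddCommGroup H] [InnerProductSpace ℝ H]
  [MeasurableSpace H] [BorelSpace H] [SecondCountableTopology H]
  {X : Ω → H} {μ : Measure Ω} {m : H}

theorem measurable_direction (hX : Measurable X) : Measurable (direction X m) := by
  unfold direction; fun_prop

theorem integrable_inner_direction [IsFiniteMeasure μ] (hX : Measurable X) (u : H) :
    Integrable (fun ω => (inner ℝ (direction X m ω) u : ℝ)) μ := by
  have := measurable_direction (m := m) hX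
  exact Integrable.of_bound (by fun_prop) ‖u‖ (ae_of_all _ fun ω => abs_inner_direction_le ω u)

/-- The first-order condition at the minimizer. Comparing `m` with `m + t • u` through the quadratic
upper bound for the norm gives `I ≤ t * K` for all `t > 0`, where `K` is finite by the inverse
moment bound at `m`. -/
theorem IsGeometricMedian.integral_inner_direction_nonpos [IsFiniteMeasure μ]
    (hm : IsGeometricMedian X μ m) (hX : Measurable X) (hA2 : InvMomentBounded X μ) (u : H) :
    ∫ ω, inner ℝ (direction X m ω) u ∂μ ≤ 0 := by
  set I := ∫ ω, inner ℝ (direction X m ω) u ∂μ with hI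
  set K := ‖u‖ ^ 2 / 2 * ∫ ω, ‖X ω - m‖⁻¹ ∂μ with hK
  have hK0 : 0 ≤ K := by
    rw [hK]; exact mul_nonneg (by positivity) (integral_nonneg fun ω => by positivity)
  have key : ∀ t : ℝ, 0 < t → I ≤ t * K := by
    intro t ht
    have hmin : 0 ≤ objective X μ (m + t • u) - objective X μ m :=
      sub_nonneg.2 (hm (Set.mem_univ _))
    rw [objective_sub_objective hX] at hmin
    have hi := integrable_inner_direction (μ := μ) (m := m) hX (t • u)
    have hle : ∫ ω, (‖X ω - (m + t • u)‖ - ‖X ω - m‖) ∂μ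
        ≤ ∫ ω, (-inner ℝ (direction X m ω) (t • u) + ‖t • u‖ ^ 2 / 2 * ‖X ω - m‖⁻¹) ∂μ := by
      refine integral_mono_ae (integrable_norm_sub_sub hX _ _)
        (hi.neg.add ((hA2.integrable_inv_norm hX m).const_mul _)) ?_
      filter_upwards [hA2.ae_ne hX m] with ω hω
      have := norm_sub_le_quadratic (sub_ne_zero.2 hω) (t • u)
      rwa [sub_sub] at this
    rw [integral_add (f := fun ω => -inner ℝ (direction X m ω) (t • u)) hi.neg ((hA2.integrable_inv_norm hX m).const_mul _), integral_neg,
      integral_const_mul] at hle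
    simp only [real_inner_smul_right, integral_const_mul, norm_smul, Real.norm_eq_abs, mul_pow,
      sq_abs] at hle
    rw [← hI] at hle
    have : t * I ≤ t * (t * K) := by rw [hK]; nlinarith
    exact le_of_mul_le_mul_left this ht
  by_contra! hpos
  -- A positive `t` with `t * K < I`; adding 1 to `K` covers `K = 0`.
  have := key (I / (2 * (K + 1))) (by positivity)
  rw [div_mul_eq_mul_div, le_div_iff₀ (by positivity)] at this
  nlinarith

theorem integrable_curvature [IsFiniteMeasure μ] (hX : Measurable X) {e : H} (he : ‖e‖ ≤ 1) :
    Integrable (curvature X m e) μ := by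
  have := measurable_direction (m := m) hX
  refine Integrable.of_bound (by unfold curvature; fun_prop) 1 (ae_of_all _ fun ω => ?_)
  rw [Real.norm_of_nonneg (curvature_nonneg he ω)]
  exact curvature_le_one he ω

/-- If the integral vanished, `X - m` would almost surely be parallel to `e`, so `⟨h', X⟩` would be
almost surely constant for every `h'` orthogonal to `e`, against `NotOnLine`. -/
theorem integral_curvature_pos [IsProbabilityMeasure μ] (hX : Measurable X)
    (hA1 : NotOnLine X μ) (hA2 : InvMomentBounded X μ) {e : H} (he : ‖e‖ = 1) :
    0 < ∫ ω, curvature X m e ω ∂μ := by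
  refine lt_of_le_of_ne (integral_nonneg fun ω => curvature_nonneg he.le ω) fun h0 => ?_
  have hz := (integral_eq_zero_iff_of_nonneg (fun ω => curvature_nonneg he.le ω)
    (integrable_curvature hX he.le)).1 h0.symm
  obtain ⟨h', horth, hvar⟩ := hA1 e
  have hc : ∀ᵐ ω ∂μ, (inner ℝ h' (X ω) : ℝ) = inner ℝ h' m := by
    filter_upwards [hz, hA2.ae_ne hX m] with ω hω hne
    have hn := norm_direction hne
    have hw : (‖X ω - m‖ + 1)⁻¹ ≠ 0 := by positivity
    have h1 : 1 - inner ℝ (direction X m ω) e ^ 2 = 0 := by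
      simpa [curvature, hw] using hω
    have h2 : ‖direction X m ω - (inner ℝ (direction X m ω) e : ℝ) • e‖ ^ 2 = 0 := by
      rw [norm_sub_sq_real, real_inner_smul_right, norm_smul, hn, he, Real.norm_eq_abs,
        mul_one, sq_abs]
      linarith
    have h3 := sub_eq_zero.1 (norm_eq_zero.1 (pow_eq_zero_iff two_ne_zero |>.1 h2))
    have h4 : X ω - m = ‖X ω - m‖ • direction X m ω := by
      rw [direction, smul_smul, mul_inv_cancel₀ (by simpa [sub_eq_zero] using hne), one_smul]
    have h5 : inner ℝ h' (X ω - m) = (0 : ℝ) := by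
      rw [h4, h3, real_inner_smul_right, real_inner_smul_right, real_inner_comm e h', horth]; simp
    rw [inner_sub_right] at h5
    linarith
  refine hvar.ne' ((evariance_eq_zero_iff (by fun_prop)).2 ?_)
  have hint : ∫ ω, (inner ℝ h' (X ω) : ℝ) ∂μ = inner ℝ h' m := by
    rw [integral_congr_ae hc]; simp
  rw [hint]; exact hc

/-- Averaging replaces compactness: apply `one_sub_inner_sq_le` to the directions at two independent
points and integrate with both weights. The left side is a positive constant free of `e`, and the
right side is at most four times the curvature integral in direction `e`. -/
theorem exists_le_integral_curvature [IsProbabilityMeasure μ] (hX : Measurable X)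
    (hA1 : NotOnLine X μ) (hA2 : InvMomentBounded X μ) :
    ∃ κ : ℝ, 0 < κ ∧ ∀ e : H, ‖e‖ = 1 → κ ≤ ∫ ω, curvature X m e ω ∂μ := by
  have hd := measurable_direction (m := m) hX
  set f : Ω → ℝ := fun ω => ∫ ω', curvature X m (direction X m ω) ω' ∂μ with hf
  have hfm : StronglyMeasurable f := by
    refine StronglyMeasurable.integral_prod_right
      (f := fun ω ω' => curvature X m (direction X m ω) ω') ?_
    refine Measurable.stronglyMeasurable ?_
    simp only [Function.uncurry_def, curvature]
    fun_prop
  have hf0 : ∀ ω, 0 ≤ f ω := fun ω => integral_nonneg fun _ => curvature_nonneg (norm_direction_le ω) _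
  have hf1 : ∀ ω, f ω ≤ 1 := fun ω => by
    have := integral_mono (μ := μ)
      (integrable_curvature (m := m) hX (norm_direction_le (X := X) (m := m) ω))
      (integrable_const 1) (fun ω' => curvature_le_one (norm_direction_le ω) ω')
    simpa using this
  set g : Ω → ℝ := fun ω => (‖X ω - m‖ + 1)⁻¹ * f ω with hg
  have hg0 : ∀ ω, 0 ≤ g ω := fun ω => mul_nonneg (by positivity) (hf0 ω)
  have hgi : Integrable g μ := by
    refine Integrable.of_bound (by have := hfm.measurable; fun_prop) 1 (ae_of_all _ fun ω => ?_)
    rw [Real.norm_of_nonneg (hg0 ω)]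
    exact mul_le_one₀ (weight_le_one ω) (hf0 ω) (hf1 ω)
  have hpos : 0 < ∫ ω, g ω ∂μ := by
    refine lt_of_le_of_ne (integral_nonneg hg0) fun h0 => ?_
    have hz := (integral_eq_zero_iff_of_nonneg hg0 hgi).1 h0.symm
    obtain ⟨ω, h1, h2⟩ := (hz.and (hA2.ae_ne hX m)).exists
    have h3 : 0 < f ω := integral_curvature_pos hX hA1 hA2 (norm_direction h2)
    have : 0 < g ω := mul_pos (by positivity) h3
    exact this.ne' h1
  refine ⟨(∫ ω, g ω ∂μ) / 4, by positivity, fun e he => ?_⟩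
  have hci := integrable_curvature (μ := μ) (m := m) hX he.le
  have hle : ∫ ω, g ω ∂μ
      ≤ ∫ ω, (2 * curvature X m e ω + 2 * ∫ ω', curvature X m e ω' ∂μ) ∂μ := by
    refine integral_mono_ae hgi ((hci.const_mul 2).add (integrable_const _)) ?_
    filter_upwards [hA2.ae_ne hX m] with ω hω
    have hfle : f ω ≤ 2 * (1 - inner ℝ (direction X m ω) e ^ 2)
        + 2 * ∫ ω', curvature X m e ω' ∂μ := by
      have : f ω ≤ ∫ ω', (2 * (1 - inner ℝ (direction X m ω) e ^ 2)
          + 2 * curvature X m e ω') ∂μ := by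
        refine integral_mono_ae (integrable_curvature hX (norm_direction_le ω))
          ((integrable_const _).add (hci.const_mul 2)) ?_
        filter_upwards [hA2.ae_ne hX m] with ω' hω'
        have h1 := one_sub_inner_sq_le (norm_direction hω) (norm_direction hω') he
        have hw := weight_le_one (X := X) (m := m) ω'
        have hw0 : 0 ≤ (‖X ω' - m‖ + 1)⁻¹ := by positivity
        have h2 := one_sub_inner_direction_sq_nonneg (X := X) (m := m) he.le ω
        simp only [curvature]
        have h3 := mul_le_mul_of_nonneg_left h1 hw0
        have h4 := mul_le_mul_of_nonneg_right hw h2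
        linarith
      rwa [integral_add (integrable_const _) (hci.const_mul 2), integral_const_mul,
        integral_const, probReal_univ, one_smul, integral_const_mul] at this
    have hw := weight_le_one (X := X) (m := m) ω
    have hw0 : 0 ≤ (‖X ω - m‖ + 1)⁻¹ := by positivity
    have hI : 0 ≤ ∫ ω', curvature X m e ω' ∂μ := integral_nonneg fun ω' => curvature_nonneg he.le ω'
    simp only [hg]
    have h3 := mul_le_mul_of_nonneg_left hfle hw0
    have h4 := mul_le_mul_of_nonneg_right hw hI
    simp only [curvature] at h3 h4 ⊢
    linarith
  rw [integral_add (hci.const_mul 2) (integrable_const _), integral_const_mul,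
    integral_const, probReal_univ, one_smul] at hle
  linarith

theorem le_objective_sub_of_norm_le_one [IsProbabilityMeasure μ] (hX : Measurable X)
    (hm : IsGeometricMedian X μ m) (hA2 : InvMomentBounded X μ) {κ : ℝ}
    (hκ : ∀ e : H, ‖e‖ = 1 → κ ≤ ∫ ω, curvature X m e ω ∂μ) {e : H} (he : ‖e‖ = 1) {t : ℝ}
    (ht0 : 0 ≤ t) (ht1 : t ≤ 1) :
    κ / 2 * t ^ 2 ≤ objective X μ (m + t • e) - objective X μ m := by
  have hn : ‖t • e‖ = t := by rw [norm_smul, he, mul_one, Real.norm_of_nonneg ht0]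
  have hi := integrable_inner_direction (μ := μ) (m := m) hX (t • e)
  have hc := (integrable_curvature (μ := μ) (m := m) hX he.le).const_mul (t ^ 2 / 2)
  have hs := hm.integral_inner_direction_nonpos hX hA2 (t • e)
  rw [objective_sub_objective hX]
  calc κ / 2 * t ^ 2 ≤ -(∫ ω, inner ℝ (direction X m ω) (t • e) ∂μ)
        + t ^ 2 / 2 * ∫ ω, curvature X m e ω ∂μ := by
        nlinarith [mul_le_mul_of_nonneg_left (hκ e he) (sq_nonneg t)]
    _ = ∫ ω, (-inner ℝ (direction X m ω) (t • e) + t ^ 2 / 2 * curvature X m e ω) ∂μ := by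
        rw [integral_add (f := fun ω => -inner ℝ (direction X m ω) (t • e)) hi.neg hc, integral_neg, integral_const_mul]
    _ ≤ _ := by
        refine integral_mono_ae (hi.neg.add hc) (integrable_norm_sub_sub hX _ _) ?_
        filter_upwards [hA2.ae_ne hX m] with ω hω
        have := quadratic_le_norm_sub (sub_ne_zero.2 hω) (u := t • e) (by rw [hn]; exact ht1)
        rw [sub_sub, hn] at this
        refine le_trans (le_of_eq ?_) this
        simp only [curvature, direction, real_inner_smul_right]
        ring

/-- The objective grows quadratically near the median and linearly away from it. -/
theorem IsGeometricMedian.exists_growth [IsProbabilityMeasure μ] (hX : Measurable X)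
    (hm : IsGeometricMedian X μ m) (hA1 : NotOnLine X μ) (hA2 : InvMomentBounded X μ) :
    ∃ κ : ℝ, 0 < κ ∧ ∀ h : H,
      κ * min (‖h - m‖ ^ 2) ‖h - m‖ ≤ objective X μ h - objective X μ m := by
  obtain ⟨κ, hκ, hle⟩ := exists_le_integral_curvature (m := m) hX hA1 hA2
  refine ⟨κ / 2, by positivity, fun h => ?_⟩
  rcases eq_or_ne h m with rfl | hne
  · simp
  have hpos : 0 < ‖h - m‖ := norm_pos_iff.2 (sub_ne_zero.2 hne)
  set t := ‖h - m‖ with ht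
  set e := t⁻¹ • (h - m) with he_def
  have he : ‖e‖ = 1 := by
    rw [he_def, norm_smul, norm_inv, Real.norm_of_nonneg hpos.le, ← ht, inv_mul_cancel₀ hpos.ne']
  have hh : h = m + t • e := by
    rw [he_def, smul_smul, mul_inv_cancel₀ hpos.ne', one_smul]; abel
  rw [hh]
  rcases le_total t 1 with h1 | h1
  · refine le_trans ?_ (le_objective_sub_of_norm_le_one hX hm hA2 hle he hpos.le h1)
    gcongr
    exact min_le_left _ _
  · have hG := le_objective_sub_of_norm_le_one hX hm hA2 hle he zero_le_one le_rfl
    have hconv : t * (objective X μ (m + (1 : ℝ) • e) - objective X μ m)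
        ≤ objective X μ (m + t • e) - objective X μ m := by
      rw [objective_sub_objective hX, objective_sub_objective hX, ← integral_const_mul]
      refine integral_mono ((integrable_norm_sub_sub hX _ _).const_mul _)
        (integrable_norm_sub_sub hX _ _) fun ω => ?_
      -- Convexity of the norm on the segment from `m` to `m + t • e`, on which `m + e` lies since
      -- `1 ≤ t`.
      have h2 : t • (X ω - (m + (1 : ℝ) • e)) = (X ω - (m + t • e)) + (t - 1) • (X ω - m) := by
        module
      have h3 := norm_add_le (X ω - (m + t • e)) ((t - 1) • (X ω - m))
      rw [← h2, norm_smul, norm_smul, Real.norm_of_nonneg hpos.le,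
        Real.norm_of_nonneg (by linarith)] at h3
      simp only
      linarith
    refine le_trans ?_ hconv
    have h5 := mul_le_mul_of_nonneg_left hG hpos.le
    have h6 : κ / 2 * min (t ^ 2) t ≤ κ / 2 * t := by
      gcongr; exact min_le_right _ _
    linarith

end Growth

/-! ### Independence of the current iterate and the next sample. -/

section Independence

variable {Ω E F G : Type*} [MeasurableSpace Ω] [MeasurableSpace E] [MeasurableSpace F]
  [MeasurableSpace G] {μ : Measure Ω}

/-- Associativity of product measures, applied to joint laws. -/
theorem indepFun_prodMk_of_indepFun_prodMk [IsProbabilityMeasure μ] {Y : Ω → E} {A : Ω → F}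
    {B : Ω → G} (hY : Measurable Y) (hA : Measurable A) (hB : Measurable B)
    (h : IndepFun Y (fun ω => (A ω, B ω)) μ) (hAB : IndepFun A B μ) :
    IndepFun (fun ω => (Y ω, A ω)) B μ := by
  have hYA : IndepFun Y A μ := h.comp measurable_id measurable_fst
  rw [indepFun_iff_map_prod_eq_prod_map_map (by fun_prop) (by fun_prop)] at h hAB hYA ⊢
  have := Measure.isProbabilityMeasure_map (μ := μ) hY.aemeasurable
  have := Measure.isProbabilityMeasure_map (μ := μ) hA.aemeasurable
  have := Measure.isProbabilityMeasure_map (μ := μ) hB.aemeasurable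
  rw [hYA, ← (measurePreserving_prodAssoc (μ.map Y) (μ.map A) (μ.map B)).symm.map_eq, ← hAB, ← h,
    Measure.map_map (by fun_prop) (by fun_prop)]
  rfl

variable {H : Type*} [NormedAddCommGroup H] [InnerProductSpace ℝ H]
  [MeasurableSpace H] [BorelSpace H] [SecondCountableTopology H]

theorem exists_iterate_eq_comp {Ω : Type*} (γ : ℕ → ℝ) (Z₁ : Ω → H) (X : ℕ → Ω → H) (k : ℕ) :
    ∃ f : H × (Finset.range k → H) → H, Measurable f ∧
      ∀ ω, iterate γ Z₁ X (k + 1) ω = f (Z₁ ω, fun i => X (i + 2) ω) := by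
  induction k with
  | zero => exact ⟨Prod.fst, measurable_fst, fun ω => rfl⟩
  | succ k ih =>
    obtain ⟨f, hf, hfe⟩ := ih
    let r : H × (Finset.range (k + 1) → H) → H := fun p =>
      f (p.1, fun i => p.2 ⟨i, Finset.mem_range.2 ((Finset.mem_range.1 i.2).trans k.lt_succ_self)⟩)
    have hr : Measurable r := by fun_prop
    let l : H × (Finset.range (k + 1) → H) → H := fun p =>
      p.2 ⟨k, Finset.self_mem_range_succ k⟩
    have hl : Measurable l := by fun_prop
    refine ⟨fun p => r p + (γ (k + 1) / ‖l p - r p‖) • (l p - r p), by fun_prop, fun ω => ?_⟩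
    simp only [iterate, hfe]
    rfl

theorem measurable_iterate {γ : ℕ → ℝ} {Z₁ : Ω → H} {X : ℕ → Ω → H} (hZ₁ : Measurable Z₁)
    (hX : ∀ n, 1 ≤ n → Measurable (X n)) {n : ℕ} (hn : 1 ≤ n) :
    Measurable (iterate γ Z₁ X n) := by
  obtain ⟨k, rfl⟩ := Nat.exists_eq_add_of_le' hn
  obtain ⟨f, hf, hfe⟩ := exists_iterate_eq_comp γ Z₁ X k
  rw [funext hfe]
  have := fun i : Finset.range k => hX (i + 2) (by omega)
  fun_prop

theorem indepFun_iterate [IsProbabilityMeasure μ] {γ : ℕ → ℝ} {Z₁ : Ω → H} {X : ℕ → Ω → H}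
    (hZ₁ : Measurable Z₁) (hX : ∀ n, 1 ≤ n → Measurable (X n))
    (hindep : iIndepFun (fun n : ℕ => X (n + 1)) μ)
    (hZ₁indep : IndepFun Z₁ (fun ω (n : ℕ) => X (n + 2) ω) μ) {n : ℕ} (hn : 1 ≤ n) :
    IndepFun (iterate γ Z₁ X n) (X (n + 1)) μ := by
  obtain ⟨k, rfl⟩ := Nat.exists_eq_add_of_le' hn
  obtain ⟨f, hf, hfe⟩ := exists_iterate_eq_comp γ Z₁ X k
  have hm : ∀ i : ℕ, Measurable (X (i + 2)) := fun i => hX _ (by omega)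
  -- The first sample is dropped: `Z₁` may depend on it, and the iterates use samples from index 2
  -- on.
  have hind : iIndepFun (fun n : ℕ => X (n + 2)) μ :=
    hindep.precomp (g := fun n : ℕ => n + 1) (add_left_injective 1)
  have hAB : IndepFun (fun ω (i : Finset.range k) => X (i + 2) ω) (X (k + 2)) μ := by
    have := hind.indepFun_finset (Finset.range k) {k} (by simp) hm
    exact this.comp measurable_id
      (measurable_pi_apply (⟨k, Finset.mem_singleton_self k⟩ : ({k} : Finset ℕ)))
  have hY : IndepFun Z₁ (fun ω => (fun i : Finset.range k => X (i + 2) ω, X (k + 2) ω)) μ := by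
    refine hZ₁indep.comp (φ := id)
      (ψ := fun x : ℕ → H => ((fun i : Finset.range k => x i), x k)) measurable_id ?_
    fun_prop
  rw [funext hfe]
  exact (indepFun_prodMk_of_indepFun_prodMk hZ₁ (by fun_prop) (hm k) hY hAB).comp hf measurable_id

end Independence

/-! ### The drift inequality. -/

section Drift

variable {Ω H : Type*} [MeasurableSpace Ω] [NormedAddCommGroup H]
  [MeasurableSpace H] [BorelSpace H] [SecondCountableTopology H]
  {X X' Y : Ω → H} {μ : Measure Ω} {m : H}

/-- Fubini on the product law of `(Y, X')` plays the role of conditioning on `Y`: the inner integral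
is `φ z * (G(m) - G(z))`, to which the growth bound applies. The weight `φ` allows for higher
moments. -/
theorem integral_mul_norm_sub_le [IsProbabilityMeasure μ] (hX' : Measurable X') (hY : Measurable Y)
    (hident : IdentDistrib X' X μ μ) (hindep : IndepFun Y X' μ) {κ : ℝ}
    (hκ : ∀ h : H, κ * min (‖h - m‖ ^ 2) ‖h - m‖ ≤ objective X μ h - objective X μ m)
    {φ : H → ℝ} (hφ : Measurable φ) (hφ0 : ∀ h, 0 ≤ φ h)
    (hint : Integrable (fun ω => φ (Y ω) * ‖Y ω - m‖) μ) :
    ∫ ω, φ (Y ω) * (‖X' ω - m‖ - ‖X' ω - Y ω‖) ∂μ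
      ≤ -κ * ∫ ω, φ (Y ω) * min (‖Y ω - m‖ ^ 2) ‖Y ω - m‖ ∂μ := by
  have hobj : ∀ h, objective X μ h - objective X μ m = ∫ ω, (‖X' ω - h‖ - ‖X' ω - m‖) ∂μ := by
    intro h
    have : ∀ h, objective X μ h = objective X' μ h := fun h =>
      ((hident.comp (u := fun x => ‖x - h‖ - ‖x‖) (by fun_prop)).integral_eq).symm
    rw [this, this, objective_sub_objective hX']
  let F : H × H → ℝ := fun p => φ p.1 * (‖p.2 - m‖ - ‖p.2 - p.1‖)
  have hF : Measurable F := by fun_prop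
  have hYX : Measurable fun ω => (Y ω, X' ω) := by fun_prop
  have hmap := (indepFun_iff_map_prod_eq_prod_map_map hY.aemeasurable hX'.aemeasurable).1 hindep
  have hPY := Measure.isProbabilityMeasure_map (μ := μ) hY.aemeasurable
  have hPX := Measure.isProbabilityMeasure_map (μ := μ) hX'.aemeasurable
  have hFi : Integrable (fun ω => F (Y ω, X' ω)) μ := by
    refine hint.mono' (hF.comp hYX).aestronglyMeasurable (ae_of_all _ fun ω => ?_)
    rw [Real.norm_eq_abs, abs_mul, abs_of_nonneg (hφ0 _)]
    exact mul_le_mul_of_nonneg_left (abs_norm_sub_sub_norm_sub_le m (X' ω) (Y ω)) (hφ0 _)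
  have hFi' : Integrable F ((μ.map Y).prod (μ.map X')) := by
    rw [← hmap, integrable_map_measure hF.aestronglyMeasurable hYX.aemeasurable]
    exact hFi
  have hFz : ∀ z, Measurable fun x => F (z, x) := fun z => hF.comp measurable_prodMk_left
  have hinner : ∀ z, ∫ x, F (z, x) ∂(μ.map X')
      = φ z * (objective X μ m - objective X μ z) := by
    intro z
    rw [integral_map hX'.aemeasurable (hFz z).aestronglyMeasurable, ← neg_sub (objective X μ z), hobj,
      ← integral_neg, ← integral_const_mul]
    simp [F]
  have heq : ∫ ω, F (Y ω, X' ω) ∂μ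
      = ∫ z, φ z * (objective X μ m - objective X μ z) ∂(μ.map Y) := by
    rw [← integral_map hYX.aemeasurable hF.aestronglyMeasurable, hmap, integral_prod _ hFi']
    simp only [hinner]
  have hi1 : Integrable (fun z => φ z * (objective X μ m - objective X μ z)) (μ.map Y) := by
    simpa only [hinner] using hFi'.integral_prod_left
  have hmin : Integrable (fun ω => φ (Y ω) * min (‖Y ω - m‖ ^ 2) ‖Y ω - m‖) μ := by
    refine hint.mono' (by fun_prop) (ae_of_all _ fun ω => ?_)
    rw [Real.norm_of_nonneg (mul_nonneg (hφ0 _) (by positivity))]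
    exact mul_le_mul_of_nonneg_left (min_le_right _ _) (hφ0 _)
  change ∫ ω, F (Y ω, X' ω) ∂μ ≤ _
  rw [heq, integral_map hY.aemeasurable hi1.aestronglyMeasurable, ← integral_const_mul]
  refine integral_mono ((integrable_map_measure hi1.aestronglyMeasurable hY.aemeasurable).1 hi1)
    (hmin.const_mul _) fun ω => ?_
  have := mul_le_mul_of_nonneg_left (hκ (Y ω)) (hφ0 (Y ω))
  simp only
  linarith

end Drift

/-! ### Deterministic recursions and elementary inequalities. -/

section Recursion

theorem one_sub_div_mul_rpow_le {t : ℝ} (ht : 0 ≤ t) {n : ℕ} (hn : 1 ≤ n) :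
    (1 - t / n) * (n : ℝ) ^ (-t) ≤ ((n + 1 : ℕ) : ℝ) ^ (-t) := by
  have hn0 : (0 : ℝ) < n := by exact_mod_cast hn
  have h1 : ((n + 1 : ℕ) : ℝ) = (1 + 1 / n) * n := by push_cast; field_simp
  have h2 : (0 : ℝ) < 1 + 1 / n := by positivity
  rw [h1, Real.mul_rpow h2.le hn0.le]
  gcongr
  rw [Real.rpow_def_of_pos h2]
  have h3 : Real.log (1 + 1 / n) ≤ 1 / n := by
    have := Real.log_le_sub_one_of_pos h2
    linarith
  have h4 := Real.add_one_le_exp (Real.log (1 + 1 / n) * -t)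
  have h5 := mul_le_mul_of_nonneg_right h3 ht
  have h6 : t / n = 1 / n * t := by ring
  linarith

/-- A sequence contracted at rate `n ^ (-s)` with perturbation `n ^ (-(s + t))`
decays like `n ^ (-t)`. -/
theorem exists_le_rpow_of_recursion {u : ℕ → ℝ} {A B s t : ℝ} (hA : 0 < A) (hB : 0 ≤ B)
    (hs0 : 0 < s) (hs1 : s < 1) (ht : 0 ≤ t)
    (hu : ∀ n : ℕ, 1 ≤ n →
      u (n + 1) ≤ (1 - A * (n : ℝ) ^ (-s)) * u n + B * (n : ℝ) ^ (-(s + t))) :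
    ∃ K : ℝ, 0 ≤ K ∧ ∀ n : ℕ, 1 ≤ n → u n ≤ K * (n : ℝ) ^ (-t) := by
  have hlim1 : Tendsto (fun n : ℕ => A * (n : ℝ) ^ (-s)) atTop (𝓝 (A * 0)) :=
    ((tendsto_rpow_neg_atTop hs0).comp tendsto_natCast_atTop_atTop).const_mul A
  rw [mul_zero] at hlim1
  have hlim2 : Tendsto (fun n : ℕ => (n : ℝ) ^ (1 - s)) atTop atTop :=
    (tendsto_rpow_atTop (by linarith)).comp tendsto_natCast_atTop_atTop
  -- Beyond `N` the contraction factor is nonnegative and `t / n ≤ (A / 2) * n ^ (-s)`, so half of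
  -- the contraction pays for the decay of `n ^ (-t)`.
  obtain ⟨N, hN⟩ := eventually_atTop.1
    (((hlim1.eventually (ge_mem_nhds zero_lt_one)).and
      (hlim2.eventually_ge_atTop (2 * t / A))).and (eventually_ge_atTop 1))
  -- The first term lets the other half of the contraction absorb `B`; the sum covers all `n ≤ N`.
  set K := 2 * B / A + ∑ i ∈ Finset.range (N + 1), |u i| * (i : ℝ) ^ t with hK
  have hsum : ∀ i ∈ Finset.range (N + 1), 0 ≤ |u i| * (i : ℝ) ^ t := fun i _ => by positivity
  have hK0 : 0 ≤ K := add_nonneg (by positivity) (Finset.sum_nonneg hsum)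
  have hKB : 2 * B ≤ K * A := by
    rw [← div_le_iff₀ hA, hK]
    linarith [Finset.sum_nonneg hsum]
  have hsmall : ∀ n : ℕ, 1 ≤ n → n ≤ N → u n ≤ K * (n : ℝ) ^ (-t) := by
    intro n h1 hn
    have hn0 : (0 : ℝ) < n := by exact_mod_cast h1
    have h2 := Finset.single_le_sum hsum (Finset.mem_range.2 (Nat.lt_succ_of_le hn))
    have h3 : |u n| * (n : ℝ) ^ t ≤ K := by
      rw [hK]; linarith [show 0 ≤ 2 * B / A by positivity]
    calc u n ≤ |u n| := le_abs_self _
      _ = |u n| * (n : ℝ) ^ t * (n : ℝ) ^ (-t) := by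
        rw [mul_assoc, ← Real.rpow_add hn0, add_neg_cancel, Real.rpow_zero, mul_one]
      _ ≤ _ := by gcongr
  have hlarge : ∀ n : ℕ, N ≤ n → u n ≤ K * (n : ℝ) ^ (-t) := by
    intro n hn
    induction n, hn using Nat.le_induction with
    | base => exact hsmall N (hN N le_rfl).2 le_rfl
    | succ n hn ih =>
      obtain ⟨⟨h1, h2⟩, h3⟩ := hN n hn
      have hn0 : (0 : ℝ) < n := by exact_mod_cast h3
      have hP : 0 < (n : ℝ) ^ (-t) := by positivity
      have hS : 0 < (n : ℝ) ^ (-s) := by positivity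
      have h4 : t / n ≤ A / 2 * (n : ℝ) ^ (-s) := by
        have h5 : (n : ℝ) ^ (1 - s) = n * (n : ℝ) ^ (-s) := by
          rw [sub_eq_add_neg, Real.rpow_add hn0, Real.rpow_one]
        rw [h5, div_le_iff₀ hA] at h2
        rw [div_le_iff₀ hn0]
        linarith
      have h6 : (n : ℝ) ^ (-(s + t)) = (n : ℝ) ^ (-s) * (n : ℝ) ^ (-t) := by
        rw [neg_add, Real.rpow_add hn0]
      have h7 := one_sub_div_mul_rpow_le ht h3
      calc u (n + 1) ≤ (1 - A * (n : ℝ) ^ (-s)) * u n + B * (n : ℝ) ^ (-(s + t)) := hu n h3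
        _ ≤ (1 - A * (n : ℝ) ^ (-s)) * (K * (n : ℝ) ^ (-t))
            + K * A / 2 * ((n : ℝ) ^ (-s) * (n : ℝ) ^ (-t)) := by
          rw [h6]
          gcongr
          linarith
        _ = K * ((1 - A / 2 * (n : ℝ) ^ (-s)) * (n : ℝ) ^ (-t)) := by ring
        _ ≤ K * ((1 - t / n) * (n : ℝ) ^ (-t)) := by gcongr
        _ ≤ _ := by gcongr
  exact ⟨K, hK0, fun n hn => (le_total n N).elim (hsmall n hn) (hlarge n)⟩

theorem exists_le_of_le_one_add_mul {u v : ℕ → ℝ} (hv : Summable v) (hv0 : ∀ n, 0 ≤ v n)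
    (hu0 : ∀ n, 0 ≤ u n) (hu : ∀ n : ℕ, 1 ≤ n → u (n + 1) ≤ (1 + v n) * u n) :
    ∃ K : ℝ, ∀ n : ℕ, 1 ≤ n → u n ≤ K := by
  have h : ∀ n : ℕ, 1 ≤ n → u n ≤ Real.exp (∑ i ∈ Finset.range n, v i) * u 1 := by
    intro n hn
    induction n, hn using Nat.le_induction with
    | base =>
      refine le_mul_of_one_le_left (hu0 1) (Real.one_le_exp (Finset.sum_nonneg fun i _ => hv0 i))
    | succ n hn ih =>
      rw [Finset.sum_range_succ, Real.exp_add]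
      calc u (n + 1) ≤ (1 + v n) * u n := hu n hn
        _ ≤ Real.exp (v n) * (Real.exp (∑ i ∈ Finset.range n, v i) * u 1) := by
          have := Real.add_one_le_exp (v n)
          have := hv0 n
          have := hu0 n
          gcongr
          linarith
        _ = _ := by ring
  refine ⟨Real.exp (∑' i, v i) * u 1, fun n hn => (h n hn).trans ?_⟩
  have := hv.sum_le_tsum (Finset.range n) fun i _ => hv0 i
  have := hu0 1
  gcongr

theorem exists_abs_one_add_pow_sub_le (p : ℕ) (L : ℝ) (hL : 0 ≤ L) :
    ∃ C : ℝ, 0 ≤ C ∧ ∀ y : ℝ, |y| ≤ L → |(1 + y) ^ p - 1 - p * y| ≤ C * y ^ 2 := by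
  induction p with
  | zero => exact ⟨0, le_rfl, fun y _ => by simp⟩
  | succ p ih =>
    obtain ⟨C, hC, h⟩ := ih
    refine ⟨(1 + L) * C + p, by positivity, fun y hy => ?_⟩
    have h1 : (1 + y) ^ (p + 1) - 1 - ((p + 1 : ℕ) : ℝ) * y
        = (1 + y) * ((1 + y) ^ p - 1 - p * y) + p * y ^ 2 := by push_cast; ring
    have h2 : |1 + y| ≤ 1 + L := (abs_add_le _ _).trans (by rw [abs_one]; linarith)
    rw [h1]
    refine (abs_add_le _ _).trans ?_
    rw [abs_mul, abs_of_nonneg (show (0 : ℝ) ≤ p * y ^ 2 by positivity), add_mul, mul_assoc]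
    gcongr
    exact h y hy

/-- For `d ≤ R` the first term suffices; for `d ≥ R` one has `R ≤ 1 + d ^ 2`, as in Markov's
inequality with a power `p`. -/
theorem sq_le_mul_min_add {R d : ℝ} (hR : 1 ≤ R) (hd : 0 ≤ d) (p : ℕ) :
    d ^ 2 ≤ R * min (d ^ 2) d + (1 + d ^ 2) ^ (p + 1) * (R ^ p)⁻¹ := by
  have hR0 : 0 < R := by linarith
  rcases le_total d R with h | h
  · have h1 : d ^ 2 ≤ R * min (d ^ 2) d := by
      rcases min_cases (d ^ 2) d with ⟨h2, -⟩ | ⟨h2, -⟩ <;> rw [h2] <;> nlinarith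
    have : 0 ≤ (1 + d ^ 2) ^ (p + 1) * (R ^ p)⁻¹ := by positivity
    linarith
  · have h1 : R ^ p ≤ (1 + d ^ 2) ^ p := by
      gcongr
      nlinarith
    have h2 : 0 ≤ R * min (d ^ 2) d := by positivity
    have h3 : d ^ 2 ≤ (1 + d ^ 2) ^ (p + 1) * (R ^ p)⁻¹ := by
      rw [← div_eq_mul_inv, le_div_iff₀ (by positivity), pow_succ' (1 + d ^ 2)]
      gcongr
      linarith
    linarith

end Recursion

/-! ### Moment inequalities for contractive processes. -/

section Moments

variable {Ω : Type*} [MeasurableSpace Ω] {μ : Measure Ω}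

theorem integrable_continuous_comp [IsFiniteMeasure μ] {f : Ω → ℝ} (hf : Measurable f)
    (hf0 : ∀ ω, 0 ≤ f ω) {M : ℝ} (hM : ∀ᵐ ω ∂μ, f ω ≤ M) {ψ : ℝ → ℝ} (hψ : Continuous ψ) :
    Integrable (fun ω => ψ (f ω)) μ := by
  obtain ⟨C, hC⟩ := (isCompact_Icc (a := (0 : ℝ)) (b := M)).exists_bound_of_continuousOn
    hψ.continuousOn
  refine Integrable.of_bound (hψ.measurable.comp hf).aestronglyMeasurable C ?_
  filter_upwards [hM] with ω hω using hC _ ⟨hf0 ω, hω⟩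

/-- Nonnegative processes `D` whose square grows by at most `2 γ δ + γ ^ 2` in each step, where
the increments `δ` have a conditional drift of at most `-κ min(D ^ 2, D)`. -/
structure IsContractive (μ : Measure Ω) (γ : ℕ → ℝ) (κ : ℝ) (D δ : ℕ → Ω → ℝ) : Prop where
  nonneg : ∀ n ω, 0 ≤ D n ω
  measurable_dist : ∀ n, 1 ≤ n → Measurable (D n)
  measurable_incr : ∀ n, 1 ≤ n → Measurable (δ n)
  bounded : ∀ n, 1 ≤ n → ∃ M, ∀ᵐ ω ∂μ, D n ω ≤ M
  abs_incr_le : ∀ n ω, |δ n ω| ≤ D n ω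
  sq_succ_le : ∀ n, 1 ≤ n → ∀ ω, D (n + 1) ω ^ 2 ≤ D n ω ^ 2 + 2 * γ n * δ n ω + γ n ^ 2
  drift : ∀ n, 1 ≤ n → ∀ ψ : ℝ → ℝ, Continuous ψ → (∀ x, 0 ≤ ψ x) →
    ∫ ω, ψ (D n ω) * δ n ω ∂μ ≤ -κ * ∫ ω, ψ (D n ω) * min (D n ω ^ 2) (D n ω) ∂μ

namespace IsContractive

variable {γ : ℕ → ℝ} {κ : ℝ} {D δ : ℕ → Ω → ℝ}

theorem integrable_comp [IsFiniteMeasure μ] (h : IsContractive μ γ κ D δ) {n : ℕ} (hn : 1 ≤ n)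
    {ψ : ℝ → ℝ} (hψ : Continuous ψ) : Integrable (fun ω => ψ (D n ω)) μ := by
  obtain ⟨M, hM⟩ := h.bounded n hn
  exact integrable_continuous_comp (h.measurable_dist n hn) (h.nonneg n) hM hψ

theorem integrable_comp_mul_incr [IsFiniteMeasure μ] (h : IsContractive μ γ κ D δ) {n : ℕ}
    (hn : 1 ≤ n) {ψ : ℝ → ℝ} (hψ : Continuous ψ) :
    Integrable (fun ω => ψ (D n ω) * δ n ω) μ := by
  refine (h.integrable_comp hn (ψ := fun x => |ψ x| * x) (by fun_prop)).mono'
    ((hψ.measurable.comp (h.measurable_dist n hn)).mul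
      (h.measurable_incr n hn)).aestronglyMeasurable (ae_of_all _ fun ω => ?_)
  rw [Real.norm_eq_abs, abs_mul]
  exact mul_le_mul_of_nonneg_left (h.abs_incr_le n ω) (abs_nonneg _)

theorem integral_comp_mul_incr_nonpos (h : IsContractive μ γ κ D δ) (hκ : 0 ≤ κ) {n : ℕ}
    (hn : 1 ≤ n) {ψ : ℝ → ℝ} (hψ : Continuous ψ) (hψ0 : ∀ x, 0 ≤ ψ x) :
    ∫ ω, ψ (D n ω) * δ n ω ∂μ ≤ 0 := by
  refine (h.drift n hn ψ hψ hψ0).trans ?_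
  rw [neg_mul, neg_nonpos]
  refine mul_nonneg hκ (integral_nonneg fun ω => mul_nonneg (hψ0 _) ?_)
  have := h.nonneg n ω
  positivity

theorem integral_sq_succ_le [IsProbabilityMeasure μ] (h : IsContractive μ γ κ D δ)
    (hγ : ∀ n, 0 ≤ γ n) {n : ℕ} (hn : 1 ≤ n) :
    ∫ ω, D (n + 1) ω ^ 2 ∂μ
      ≤ ∫ ω, D n ω ^ 2 ∂μ - 2 * κ * γ n * ∫ ω, min (D n ω ^ 2) (D n ω) ∂μ + γ n ^ 2 := by
  have i1 := h.integrable_comp hn (ψ := fun x => x ^ 2) (by fun_prop)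
  have i2 := h.integrable_comp (n := n + 1) (by omega) (ψ := fun x => x ^ 2) (by fun_prop)
  have i3 := (h.integrable_comp_mul_incr hn (ψ := fun _ => 1) (by fun_prop)).const_mul (2 * γ n)
  have hd := h.drift n hn (fun _ => 1) (by fun_prop) (fun _ => zero_le_one)
  have hle := integral_mono i2 ((i1.add i3).add (integrable_const (γ n ^ 2)))
    (fun ω => by simpa using h.sq_succ_le n hn ω)
  rw [integral_add' (i1.add i3) (integrable_const _), integral_add' i1 i3, integral_const_mul,
    integral_const, probReal_univ, one_smul] at hle
  simp only [one_mul] at hd hle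
  have := mul_le_mul_of_nonneg_left hd (hγ n)
  linarith

/-- Square the one-step bound: `δ² ≤ D²` merges two terms into `6γ²D²`, and the term `4γ³δ` has
nonpositive mean. -/
theorem integral_pow_four_succ_le [IsProbabilityMeasure μ] (h : IsContractive μ γ κ D δ)
    (hκ : 0 ≤ κ) (hγ : ∀ n, 0 ≤ γ n) {n : ℕ} (hn : 1 ≤ n) :
    ∫ ω, D (n + 1) ω ^ 4 ∂μ
      ≤ ∫ ω, D n ω ^ 4 ∂μ - 4 * κ * γ n * ∫ ω, D n ω ^ 2 * min (D n ω ^ 2) (D n ω) ∂μ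
        + 6 * γ n ^ 2 * ∫ ω, D n ω ^ 2 ∂μ + γ n ^ 4 := by
  have i1 := h.integrable_comp hn (ψ := fun x => x ^ 4) (by fun_prop)
  have i2 := h.integrable_comp (n := n + 1) (by omega) (ψ := fun x => x ^ 4) (by fun_prop)
  have i3 := (h.integrable_comp_mul_incr hn (ψ := fun x => x ^ 2) (by fun_prop)).const_mul (4 * γ n)
  have i4 := (h.integrable_comp_mul_incr hn (ψ := fun _ => 1) (by fun_prop)).const_mul (4 * γ n ^ 3)
  have i5 := (h.integrable_comp hn (ψ := fun x => x ^ 2) (by fun_prop)).const_mul (6 * γ n ^ 2)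
  have hd := h.drift n hn (fun x => x ^ 2) (by fun_prop) (fun _ => by positivity)
  have hd' := h.integral_comp_mul_incr_nonpos hκ hn (ψ := fun _ => 1) (by fun_prop)
    (fun _ => zero_le_one)
  have hle := integral_mono i2
    ((((i1.add i3).add i4).add i5).add (integrable_const (γ n ^ 4))) (fun ω => by
      have h1 := h.sq_succ_le n hn ω
      have h2 : δ n ω ^ 2 ≤ D n ω ^ 2 := sq_le_sq' (abs_le.1 (h.abs_incr_le n ω)).1
        (abs_le.1 (h.abs_incr_le n ω)).2
      have h3 : (D (n + 1) ω ^ 2) ^ 2 ≤ (D n ω ^ 2 + 2 * γ n * δ n ω + γ n ^ 2) ^ 2 := by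
        gcongr
      have h4 := mul_le_mul_of_nonneg_left h2 (sq_nonneg (γ n))
      simp only [Pi.add_apply]
      nlinarith)
  rw [integral_add' (((i1.add i3).add i4).add i5) (integrable_const _),
    integral_add' ((i1.add i3).add i4) i5, integral_add' (i1.add i3) i4, integral_add' i1 i3,
    integral_const_mul, integral_const_mul, integral_const_mul, integral_const_mul,
    integral_const, probReal_univ, one_smul] at hle
  simp only [one_mul] at hd' hle
  have h5 := mul_le_mul_of_nonneg_left hd (hγ n)
  have h6 := mul_nonneg_of_nonpos_of_nonpos hd' (neg_nonpos.2 (pow_nonneg (hγ n) 3))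
  linarith

/-- The part of the increment linear in `δ` has nonpositive mean, and the rest is at most `K γ_n²`
times the current moment; the product of the factors `1 + K γ_n²` is bounded. -/
theorem exists_integral_pow_le [IsProbabilityMeasure μ] (h : IsContractive μ γ κ D δ)
    (hκ : 0 ≤ κ) (hγ : ∀ n, 0 ≤ γ n) {c : ℝ} (hγc : ∀ n, 1 ≤ n → γ n ≤ c)
    (hsum : Summable fun n => γ n ^ 2) (p : ℕ) :
    ∃ C : ℝ, ∀ n, 1 ≤ n → ∫ ω, (1 + D n ω ^ 2) ^ (p + 1) ∂μ ≤ C := by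
  have hc : 0 ≤ c := (hγ 1).trans (hγc 1 le_rfl)
  obtain ⟨C, hC, hbin⟩ := exists_abs_one_add_pow_sub_le (p + 1) (c * (1 + c)) (by positivity)
  set K : ℝ := (p + 1 : ℕ) + C * (1 + c) ^ 2 with hK
  have hK0 : 0 ≤ K := by positivity
  refine exists_le_of_le_one_add_mul (v := fun n => K * γ n ^ 2) (hsum.mul_left K)
    (fun n => by positivity) (fun n => integral_nonneg fun ω => by positivity) fun n hn => ?_
  have i1 := (h.integrable_comp hn (ψ := fun x => (1 + x ^ 2) ^ (p + 1)) (by fun_prop)).const_mul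
    (1 + K * γ n ^ 2)
  have i2 := h.integrable_comp (n := n + 1) (by omega) (ψ := fun x => (1 + x ^ 2) ^ (p + 1))
    (by fun_prop)
  have i3 := (h.integrable_comp_mul_incr hn (ψ := fun x => (1 + x ^ 2) ^ p) (by fun_prop)).const_mul
    ((p + 1 : ℕ) * (2 * γ n))
  have hd := h.integral_comp_mul_incr_nonpos hκ hn (ψ := fun x => (1 + x ^ 2) ^ p) (by fun_prop)
    (fun _ => by positivity)
  have hle := integral_mono i2 (i1.add i3) (fun ω => by
    set d := D n ω with hd_def
    have hd0 : 0 ≤ d := h.nonneg n ω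
    have hF : 0 < 1 + d ^ 2 := by positivity
    set x := 2 * γ n * δ n ω + γ n ^ 2 with hx
    -- The relative increment of `1 + D²`, of size `O(γ_n)`, so the binomial remainder is `O(γ_n²)`.
    set y := x / (1 + d ^ 2) with hy
    have hxy : x = y * (1 + d ^ 2) := by rw [hy]; field_simp
    have hγn := hγ n
    have habs : |y| ≤ γ n * (1 + c) := by
      rw [hy, abs_div, abs_of_pos hF, div_le_iff₀ hF]
      have h1 : |x| ≤ 2 * γ n * d + γ n ^ 2 := by
        refine (abs_add_le _ _).trans ?_
        rw [abs_mul, abs_of_nonneg (by positivity : 0 ≤ 2 * γ n), abs_of_nonneg (sq_nonneg (γ n))]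
        have := h.abs_incr_le n ω
        gcongr
      have h2 : 2 * d + γ n ≤ (1 + c) * (1 + d ^ 2) := by
        nlinarith [sq_nonneg (d - 1), hγc n hn, mul_nonneg hc (sq_nonneg d)]
      calc |x| ≤ γ n * (2 * d + γ n) := by linarith
        _ ≤ γ n * ((1 + c) * (1 + d ^ 2)) := by gcongr
        _ = _ := by ring
    have hyL : |y| ≤ c * (1 + c) := habs.trans (by gcongr; exact hγc n hn)
    have hy2 : y ^ 2 ≤ γ n ^ 2 * (1 + c) ^ 2 := by
      rw [← sq_abs, ← mul_pow]; gcongr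
    have hb : (1 + y) ^ (p + 1) ≤ 1 + (p + 1 : ℕ) * y + C * (γ n ^ 2 * (1 + c) ^ 2) := by
      have h1 := (abs_le.1 (hbin y hyL)).2
      have h2 := mul_le_mul_of_nonneg_left hy2 hC
      linarith
    have h1 : 1 + D (n + 1) ω ^ 2 ≤ (1 + d ^ 2) * (1 + y) := by
      have := h.sq_succ_le n hn ω
      rw [← hd_def] at this
      linarith
    have h2 : (1 + d ^ 2) ^ (p + 1) * ((p + 1 : ℕ) * y) = (p + 1 : ℕ) * ((1 + d ^ 2) ^ p * x) := by
      rw [hxy]; ring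
    have h3 : (1 + d ^ 2) ^ p * γ n ^ 2 ≤ (1 + d ^ 2) ^ (p + 1) * γ n ^ 2 := by
      gcongr <;> nlinarith
    have h4 := mul_le_mul_of_nonneg_left h3 (Nat.cast_nonneg (α := ℝ) (p + 1))
    simp only [Pi.add_apply, ← hd_def]
    calc (1 + D (n + 1) ω ^ 2) ^ (p + 1) ≤ ((1 + d ^ 2) * (1 + y)) ^ (p + 1) := by gcongr
      _ = (1 + d ^ 2) ^ (p + 1) * (1 + y) ^ (p + 1) := mul_pow _ _ _
      _ ≤ (1 + d ^ 2) ^ (p + 1) * (1 + (p + 1 : ℕ) * y + C * (γ n ^ 2 * (1 + c) ^ 2)) := by gcongr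
      _ = (1 + d ^ 2) ^ (p + 1) + (p + 1 : ℕ) * (2 * γ n) * ((1 + d ^ 2) ^ p * δ n ω)
          + (p + 1 : ℕ) * ((1 + d ^ 2) ^ p * γ n ^ 2)
          + C * (1 + c) ^ 2 * γ n ^ 2 * (1 + d ^ 2) ^ (p + 1) := by
        rw [mul_add, mul_add, h2, hx]; ring
      _ ≤ _ := by rw [hK]; linarith)
  rw [integral_add' i1 i3, integral_const_mul, integral_const_mul] at hle
  have : (p + 1 : ℕ) * (2 * γ n) * ∫ ω, (1 + D n ω ^ 2) ^ p * δ n ω ∂μ ≤ 0 :=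
    mul_nonpos_of_nonneg_of_nonpos (by have := hγ n; positivity) hd
  linarith

/-- Truncation at level `R`: the drift controls `E[D ^ k * D ^ 2]` up to a factor `R` and a
remainder bounded by a high moment over a power of `R`. -/
theorem integral_le_mul_integral_min_add [IsProbabilityMeasure μ] (h : IsContractive μ γ κ D δ)
    {n : ℕ} (hn : 1 ≤ n) {R : ℝ} (hR : 1 ≤ R) (p : ℕ) {ψ : ℝ → ℝ} (hψ : Continuous ψ)
    (hψ0 : ∀ x, 0 ≤ ψ x) (hψ1 : ∀ x, ψ x ≤ 1 + x ^ 2) :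
    ∫ ω, ψ (D n ω) * D n ω ^ 2 ∂μ ≤ R * ∫ ω, ψ (D n ω) * min (D n ω ^ 2) (D n ω) ∂μ
      + (∫ ω, (1 + D n ω ^ 2) ^ (p + 2) ∂μ) * (R ^ p)⁻¹ := by
  have hR0 : 0 < R := by linarith
  have i1 := (h.integrable_comp hn (ψ := fun x => ψ x * min (x ^ 2) x) (by fun_prop)).const_mul R
  have i2 := h.integrable_comp hn (ψ := fun x => ψ x * x ^ 2) (by fun_prop)
  have i3 := (h.integrable_comp hn (ψ := fun x => (1 + x ^ 2) ^ (p + 2)) (by fun_prop)).mul_const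
    (R ^ p)⁻¹
  have hle := integral_mono i2 (i1.add i3) (fun ω => by
    have h1 := mul_le_mul_of_nonneg_left (sq_le_mul_min_add hR (h.nonneg n ω) p) (hψ0 (D n ω))
    have h2 : ψ (D n ω) * ((1 + D n ω ^ 2) ^ (p + 1) * (R ^ p)⁻¹)
        ≤ (1 + D n ω ^ 2) * ((1 + D n ω ^ 2) ^ (p + 1) * (R ^ p)⁻¹) := by
      gcongr; exact hψ1 _
    have h3 : (1 + D n ω ^ 2) * ((1 + D n ω ^ 2) ^ (p + 1) * (R ^ p)⁻¹)
        = (1 + D n ω ^ 2) ^ (p + 2) * (R ^ p)⁻¹ := by ring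
    simp only [Pi.add_apply]
    linarith)
  rwa [integral_add' i1 i3, integral_const_mul, integral_mul_const] at hle

end IsContractive

end Moments

/-! ### Convergence rates for polynomial steps. -/

section Rates

variable {Ω : Type*} [MeasurableSpace Ω] {μ : Measure Ω}

theorem stepSize_nonneg {c α : ℝ} (hc : 0 ≤ c) (n : ℕ) : 0 ≤ stepSize c α n :=
  mul_nonneg hc (by positivity)

theorem stepSize_le {c α : ℝ} (hc : 0 ≤ c) (hα : 0 ≤ α) {n : ℕ} (hn : 1 ≤ n) :
    stepSize c α n ≤ c :=
  mul_le_of_le_one_right hc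
    (Real.rpow_le_one_of_one_le_of_nonpos (by exact_mod_cast hn) (by linarith))

theorem summable_stepSize_sq {c α : ℝ} (hα : 1 / 2 < α) :
    Summable fun n => stepSize c α n ^ 2 := by
  have h : ∀ n : ℕ, stepSize c α n ^ 2 = c ^ 2 * (n : ℝ) ^ (-(2 * α)) := fun n => by
    rw [stepSize, mul_pow, ← Real.rpow_natCast ((n : ℝ) ^ (-α)), ← Real.rpow_mul (by positivity)]
    congr 2
    push_cast; ring
  simp only [h]
  exact (Real.summable_nat_rpow.2 (by linarith)).mul_left _

namespace IsContractive

variable {κ c α : ℝ} {D δ : ℕ → Ω → ℝ}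

theorem exists_rpow_mul_integral_sub_le [IsProbabilityMeasure μ]
    (h : IsContractive μ (stepSize c α) κ D δ) (hκ : 0 ≤ κ) (hc : 0 ≤ c) (hα : 1 / 2 < α)
    {ε : ℝ} (hε : 0 < ε) {ψ : ℝ → ℝ} (hψ : Continuous ψ) (hψ0 : ∀ x, 0 ≤ ψ x)
    (hψ1 : ∀ x, ψ x ≤ 1 + x ^ 2) :
    ∃ C : ℝ, 0 ≤ C ∧ ∀ n : ℕ, 1 ≤ n →
      (n : ℝ) ^ (-ε) * ∫ ω, ψ (D n ω) * D n ω ^ 2 ∂μ - C * (n : ℝ) ^ (-2 : ℝ)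
        ≤ ∫ ω, ψ (D n ω) * min (D n ω ^ 2) (D n ω) ∂μ := by
  -- With `R = n ^ ε`, this `p` makes `R ^ (-p) ≤ n ^ (-2)`, negligible in both later recursions.
  obtain ⟨p, hp⟩ := exists_nat_ge (2 / ε)
  rw [div_le_iff₀ hε] at hp
  obtain ⟨C, hC⟩ := h.exists_integral_pow_le hκ (stepSize_nonneg hc)
    (fun n hn => stepSize_le hc (by linarith) hn) (summable_stepSize_sq hα) (p + 1)
  have hC0 : 0 ≤ C := (integral_nonneg fun ω => by positivity).trans (hC 1 le_rfl)
  refine ⟨C, hC0, fun n hn => ?_⟩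
  have hn1 : (1 : ℝ) ≤ n := by exact_mod_cast hn
  have hn0 : (0 : ℝ) < n := by linarith
  have hR : 1 ≤ (n : ℝ) ^ ε := Real.one_le_rpow hn1 hε.le
  have htr := h.integral_le_mul_integral_min_add hn hR p hψ hψ0 hψ1
  have hRp : (((n : ℝ) ^ ε) ^ p)⁻¹ ≤ (n : ℝ) ^ (-2 : ℝ) := by
    rw [← Real.rpow_natCast, ← Real.rpow_mul hn0.le, ← Real.rpow_neg hn0.le]
    exact Real.rpow_le_rpow_of_exponent_le hn1 (by linarith)
  have h1 : (∫ ω, (1 + D n ω ^ 2) ^ (p + 2) ∂μ) * (((n : ℝ) ^ ε) ^ p)⁻¹ ≤ C * (n : ℝ) ^ (-2 : ℝ) := by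
    have := hC n hn
    gcongr
  have hRi : (n : ℝ) ^ (-ε) * (n : ℝ) ^ ε = 1 := by
    rw [← Real.rpow_add hn0, neg_add_cancel, Real.rpow_zero]
  have hRi1 : (n : ℝ) ^ (-ε) ≤ 1 := Real.rpow_le_one_of_one_le_of_nonpos hn1 (by linarith)
  have hRi0 : 0 ≤ (n : ℝ) ^ (-ε) := by positivity
  have h2 := mul_le_mul_of_nonneg_left (htr.trans (add_le_add_right h1 _)) hRi0
  rw [mul_add, ← mul_assoc, hRi, one_mul] at h2
  have h3 : (n : ℝ) ^ (-ε) * (C * (n : ℝ) ^ (-2 : ℝ)) ≤ C * (n : ℝ) ^ (-2 : ℝ) :=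
    mul_le_of_le_one_left (by positivity) hRi1
  linarith

theorem exists_integral_sq_le_of_lt [IsProbabilityMeasure μ]
    (h : IsContractive μ (stepSize c α) κ D δ) (hκ : 0 < κ) (hc : 0 < c) (hα : 1 / 2 < α)
    {ε : ℝ} (hε : 0 < ε) (hε1 : α + ε < 1) (hεα : ε ≤ α) :
    ∃ K : ℝ, 0 ≤ K ∧ ∀ n : ℕ, 1 ≤ n → ∫ ω, D n ω ^ 2 ∂μ ≤ K * (n : ℝ) ^ (-(α - ε)) := by
  obtain ⟨C, hC, hJ⟩ := h.exists_rpow_mul_integral_sub_le hκ.le hc.le hα hε (ψ := fun _ => 1)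
    (by fun_prop) (fun _ => zero_le_one) (fun x => by linarith [sq_nonneg x])
  simp only [one_mul] at hJ
  refine exists_le_rpow_of_recursion (A := 2 * κ * c) (B := 2 * κ * c * C + c ^ 2) (s := α + ε)
    (by positivity) (by positivity) (by linarith) hε1 (sub_nonneg.2 hεα) fun n hn => ?_
  have hn1 : (1 : ℝ) ≤ n := by exact_mod_cast hn
  have hn0 : (0 : ℝ) < n := by linarith
  have hrec := h.integral_sq_succ_le (stepSize_nonneg hc.le) hn
  simp only [stepSize] at hrec
  have e1 : (n : ℝ) ^ (-(α + ε)) = (n : ℝ) ^ (-α) * (n : ℝ) ^ (-ε) := by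
    rw [← Real.rpow_add hn0]; ring_nf
  have e2 : (n : ℝ) ^ (-(α + ε + (α - ε))) = (n : ℝ) ^ (-α) * (n : ℝ) ^ (-α) := by
    rw [← Real.rpow_add hn0]; ring_nf
  have e3 : (n : ℝ) ^ (-2 : ℝ) ≤ (n : ℝ) ^ (-α) :=
    Real.rpow_le_rpow_of_exponent_le hn1 (by linarith)
  have h1 := mul_le_mul_of_nonneg_left (hJ n hn)
    (show 0 ≤ 2 * κ * (c * (n : ℝ) ^ (-α)) by positivity)
  have h2 := mul_le_mul_of_nonneg_left e3 (show 0 ≤ 2 * κ * c * C * (n : ℝ) ^ (-α) by positivity)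
  rw [e1, e2]
  linarith

theorem exists_integral_pow_four_le [IsProbabilityMeasure μ]
    (h : IsContractive μ (stepSize c α) κ D δ) (hκ : 0 < κ) (hc : 0 < c) (hα : 1 / 2 < α)
    (hα1 : α < 1) {β : ℝ} (hβ : β < 2 * α) :
    ∃ K : ℝ, 0 ≤ K ∧ ∀ n : ℕ, 1 ≤ n → ∫ ω, D n ω ^ 4 ∂μ ≤ K * (n : ℝ) ^ (-β) := by
  -- The first bound keeps the contraction exponent `α + ε` below 1; the second gives `β < 2 * α - 2
  -- * ε`.
  obtain ⟨ε, hε, hεm⟩ := exists_between (lt_min (show 0 < 1 - α by linarith)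
    (show 0 < (2 * α - β) / 2 by linarith))
  obtain ⟨hε1, hεβ⟩ := lt_min_iff.1 hεm
  obtain ⟨K₂, hK₂, ha⟩ := h.exists_integral_sq_le_of_lt hκ hc hα hε (by linarith) (by linarith)
  obtain ⟨C, hC, hJ⟩ := h.exists_rpow_mul_integral_sub_le hκ.le hc.le hα hε (ψ := fun x => x ^ 2)
    (by fun_prop) (fun _ => by positivity) (fun x => by linarith)
  have hfour : ∀ n, ∫ ω, D n ω ^ 2 * D n ω ^ 2 ∂μ = ∫ ω, D n ω ^ 4 ∂μ := fun n => by
    congr 1; ext ω; ring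
  simp only [hfour] at hJ
  obtain ⟨K, hK, hb⟩ := exists_le_rpow_of_recursion (u := fun n => ∫ ω, D n ω ^ 4 ∂μ)
    (A := 4 * κ * c) (B := 4 * κ * c * C + 6 * c ^ 2 * K₂ + c ^ 4) (s := α + ε)
    (t := 2 * α - 2 * ε)
    (by positivity) (by positivity) (by linarith) (by linarith) (by linarith) fun n hn => by
      have hn1 : (1 : ℝ) ≤ n := by exact_mod_cast hn
      have hn0 : (0 : ℝ) < n := by linarith
      have hrec := h.integral_pow_four_succ_le hκ.le (stepSize_nonneg hc.le) hn
      simp only [stepSize] at hrec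
      have e1 : (n : ℝ) ^ (-(α + ε)) = (n : ℝ) ^ (-α) * (n : ℝ) ^ (-ε) := by
        rw [← Real.rpow_add hn0]; ring_nf
      have e2 : (n : ℝ) ^ (-(α + ε + (2 * α - 2 * ε)))
          = (n : ℝ) ^ (-α) * ((n : ℝ) ^ (-α) * (n : ℝ) ^ (-(α - ε))) := by
        rw [← Real.rpow_add hn0, ← Real.rpow_add hn0]; ring_nf
      have e3 : (n : ℝ) ^ (-2 : ℝ) ≤ (n : ℝ) ^ (-α) * (n : ℝ) ^ (-(α - ε)) := by
        rw [← Real.rpow_add hn0]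
        exact Real.rpow_le_rpow_of_exponent_le hn1 (by linarith)
      have e4 : (n : ℝ) ^ (-α) * (n : ℝ) ^ (-α) ≤ (n : ℝ) ^ (-(α - ε)) := by
        rw [← Real.rpow_add hn0]
        exact Real.rpow_le_rpow_of_exponent_le hn1 (by linarith)
      have h1 := mul_le_mul_of_nonneg_left (hJ n hn)
        (show 0 ≤ 4 * κ * (c * (n : ℝ) ^ (-α)) by positivity)
      have h2 := mul_le_mul_of_nonneg_left e3
        (show 0 ≤ 4 * κ * c * C * (n : ℝ) ^ (-α) by positivity)
      have h3 := mul_le_mul_of_nonneg_left (ha n hn)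
        (show 0 ≤ 6 * (c * (n : ℝ) ^ (-α)) ^ 2 by positivity)
      have h4 := mul_le_mul_of_nonneg_left e4
        (show 0 ≤ c ^ 4 * ((n : ℝ) ^ (-α) * (n : ℝ) ^ (-α)) by positivity)
      rw [e1, e2]
      linarith
  refine ⟨K, hK, fun n hn => (hb n hn).trans ?_⟩
  have hn1 : (1 : ℝ) ≤ n := by exact_mod_cast hn
  gcongr
  linarith

/-- The fourth moment bound with exponent `α` makes the cost of replacing `min(D², D)` by `D²` of
order `γ_n n ^ (-α)`, the same as the noise term `γ_n²`. -/
theorem exists_integral_sq_le [IsProbabilityMeasure μ]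
    (h : IsContractive μ (stepSize c α) κ D δ) (hκ : 0 < κ) (hc : 0 < c) (hα : 1 / 2 < α)
    (hα1 : α < 1) :
    ∃ K : ℝ, 0 ≤ K ∧ ∀ n : ℕ, 1 ≤ n → ∫ ω, D n ω ^ 2 ∂μ ≤ K * (n : ℝ) ^ (-α) := by
  obtain ⟨K, hK, hb⟩ := h.exists_integral_pow_four_le hκ hc hα hα1 (β := α)
    (by linarith)
  refine exists_le_rpow_of_recursion (A := 2 * κ * c) (B := 2 * κ * c * K + c ^ 2)
    (by positivity) (by positivity) (by linarith) hα1 (by linarith) fun n hn => ?_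
  have hn1 : (1 : ℝ) ≤ n := by exact_mod_cast hn
  have hn0 : (0 : ℝ) < n := by linarith
  have hrec := h.integral_sq_succ_le (stepSize_nonneg hc.le) hn
  have i1 := h.integrable_comp hn (ψ := fun x => min (x ^ 2) x) (by fun_prop)
  have i2 := h.integrable_comp hn (ψ := fun x => x ^ 4) (by fun_prop)
  have i3 := h.integrable_comp hn (ψ := fun x => x ^ 2) (by fun_prop)
  have hJ := integral_mono i3 (i1.add i2) (fun ω => by
    have hd := h.nonneg n ω
    simp only [Pi.add_apply]
    rcases min_cases (D n ω ^ 2) (D n ω) with ⟨h2, h3⟩ | ⟨h2, h3⟩ <;> rw [h2]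
    · have : 0 ≤ D n ω ^ 4 := by positivity
      linarith
    · have h4 : 1 ≤ D n ω := by nlinarith
      have h5 : D n ω ^ 2 ≤ D n ω ^ 4 := pow_le_pow_right₀ h4 (by norm_num)
      linarith)
  rw [integral_add' i1 i2] at hJ
  simp only [stepSize] at hrec
  have e2 : (n : ℝ) ^ (-(α + α)) = (n : ℝ) ^ (-α) * (n : ℝ) ^ (-α) := by
    rw [← Real.rpow_add hn0]; ring_nf
  have hA : 0 ≤ 2 * κ * (c * (n : ℝ) ^ (-α)) := by positivity
  have h1 := mul_le_mul_of_nonneg_left hJ hA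
  have h2 := mul_le_mul_of_nonneg_left (hb n hn) hA
  rw [e2]
  linarith

end IsContractive

end Rates

/-! ### The iterates form a contractive process. -/

section Algorithm

variable {Ω H : Type*} [MeasurableSpace Ω] [NormedAddCommGroup H] [InnerProductSpace ℝ H]
  {μ : Measure Ω} {m : H}

theorem norm_iterate_succ_sub_sq_le {Ω : Type*} {γ : ℕ → ℝ} (hγ : ∀ n, 0 ≤ γ n) (Z₁ : Ω → H) (X : ℕ → Ω → H)
    {n : ℕ} (hn : 1 ≤ n) (ω : Ω) :
    ‖iterate γ Z₁ X (n + 1) ω - m‖ ^ 2 ≤ ‖iterate γ Z₁ X n ω - m‖ ^ 2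
      + 2 * γ n * (‖X (n + 1) ω - m‖ - ‖X (n + 1) ω - iterate γ Z₁ X n ω‖) + γ n ^ 2 := by
  obtain ⟨k, rfl⟩ := Nat.exists_eq_add_of_le' hn
  exact norm_step_sq_le (hγ _) m (X (k + 2) ω) (iterate γ Z₁ X (k + 1) ω)

/-- A step moves the iterate by at most `γ n`. The bound depends on `n` and serves only
integrability. -/
theorem exists_norm_iterate_sub_le {γ : ℕ → ℝ} (hγ : ∀ n, 0 ≤ γ n) {Z₁ : Ω → H} (X : ℕ → Ω → H)
    (hbdd : ∃ M : ℝ, ∀ᵐ ω ∂μ, ‖Z₁ ω‖ ≤ M) {n : ℕ} (hn : 1 ≤ n) :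
    ∃ M : ℝ, ∀ᵐ ω ∂μ, ‖iterate γ Z₁ X n ω - m‖ ≤ M := by
  induction n, hn using Nat.le_induction with
  | base =>
    obtain ⟨M, hM⟩ := hbdd
    refine ⟨M + ‖m‖, ?_⟩
    filter_upwards [hM] with ω hω
    exact (norm_sub_le _ _).trans (by simpa [iterate] using hω)
  | succ n hn ih =>
    obtain ⟨M, hM⟩ := ih
    refine ⟨M + γ n, ?_⟩
    filter_upwards [hM] with ω hω
    have h0 := norm_nonneg (iterate γ Z₁ X n ω - m)
    have hγn := hγ n
    refine le_trans ?_ (add_le_add_left hω (γ n))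
    refine abs_le_of_sq_le_sq' ?_ (by positivity) |>.2
    have h1 := norm_iterate_succ_sub_sq_le (m := m) hγ Z₁ X hn ω
    have h2 := mul_le_mul_of_nonneg_left (abs_le.1 (abs_norm_sub_sub_norm_sub_le m (X (n + 1) ω)
      (iterate γ Z₁ X n ω))).2 hγn
    nlinarith

theorem isContractive_iterate [MeasurableSpace H] [BorelSpace H] [SecondCountableTopology H]
    [IsProbabilityMeasure μ] {X : Ω → H} {κ : ℝ}
    (hκ : ∀ h : H, κ * min (‖h - m‖ ^ 2) ‖h - m‖ ≤ objective X μ h - objective X μ m)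
    {Xs : ℕ → Ω → H} (hXs : ∀ n, 1 ≤ n → Measurable (Xs n))
    (hident : ∀ n, 1 ≤ n → IdentDistrib (Xs n) X μ μ)
    (hindep : iIndepFun (fun n : ℕ => Xs (n + 1)) μ)
    {Z₁ : Ω → H} (hZ₁ : Measurable Z₁) (hbdd : ∃ M : ℝ, ∀ᵐ ω ∂μ, ‖Z₁ ω‖ ≤ M)
    (hZ₁indep : IndepFun Z₁ (fun ω (n : ℕ) => Xs (n + 2) ω) μ)
    {γ : ℕ → ℝ} (hγ : ∀ n, 0 ≤ γ n) :
    IsContractive μ γ κ (fun n ω => ‖iterate γ Z₁ Xs n ω - m‖)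
      (fun n ω => ‖Xs (n + 1) ω - m‖ - ‖Xs (n + 1) ω - iterate γ Z₁ Xs n ω‖) where
  nonneg n ω := norm_nonneg _
  measurable_dist n hn := ((measurable_iterate hZ₁ hXs hn).sub_const m).norm
  measurable_incr n hn := ((hXs (n + 1) (by omega)).sub_const m).norm.sub
    ((hXs (n + 1) (by omega)).sub (measurable_iterate hZ₁ hXs hn)).norm
  bounded n hn := exists_norm_iterate_sub_le hγ Xs hbdd hn
  abs_incr_le n ω := abs_norm_sub_sub_norm_sub_le _ _ _
  sq_succ_le n hn ω := norm_iterate_succ_sub_sq_le hγ Z₁ Xs hn ω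
  drift n hn ψ hψ hψ0 := by
    obtain ⟨M, hM⟩ := exists_norm_iterate_sub_le (m := m) hγ Xs hbdd hn
    have hZ := measurable_iterate (γ := γ) hZ₁ hXs hn
    exact integral_mul_norm_sub_le (hXs (n + 1) (by omega)) hZ (hident (n + 1) (by omega))
      (indepFun_iterate hZ₁ hXs hindep hZ₁indep hn) hκ (φ := fun h => ψ ‖h - m‖)
      (hψ.measurable.comp (by fun_prop)) (fun _ => hψ0 _)
      (integrable_continuous_comp (ψ := fun x => ψ x * x) (hZ.sub_const m).norm
        (fun _ => norm_nonneg _) hM (by fun_prop))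

end Algorithm

end GeomMedian

theorem theorem3p1
    {H : Type*} [NormedAddCommGroup H] [InnerProductSpace ℝ H] [CompleteSpace H]
    [TopologicalSpace.SeparableSpace H] [MeasurableSpace H] [BorelSpace H]
    {Ω : Type*} [MeasurableSpace Ω] (μ : Measure Ω) [IsProbabilityMeasure μ]
    -- the random variable `X` and its geometric median `m`
    (X : Ω → H) (hX : Measurable X)
    (m : H) (hm : GeomMedian.IsGeometricMedian X μ m)
    (hA1 : GeomMedian.NotOnLine X μ)
    (hA2 : GeomMedian.InvMomentBounded X μ)
    (hA3 : GeomMedian.InvSqMomentBounded X μ)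
    -- i.i.d. copies `X₁, X₂, …` of `X`
    (Xs : ℕ → Ω → H) (hXs : ∀ n, 1 ≤ n → Measurable (Xs n))
    (hident : ∀ n, 1 ≤ n → IdentDistrib (Xs n) X μ μ)
    (hindep : iIndepFun (fun n : ℕ => Xs (n + 1)) μ)
    -- the bounded starting point `Z₁`, independent of `(X₂, X₃, …)`
    (Z₁ : Ω → H) (hZ₁ : Measurable Z₁)
    (hbdd : ∃ M : ℝ, ∀ᵐ ω ∂μ, ‖Z₁ ω‖ ≤ M)
    (hZ₁indep : IndepFun Z₁ (fun ω (n : ℕ) => Xs (n + 2) ω) μ)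
    (c α : ℝ) (hc : 0 < c) (hα : 1 / 2 < α) (hα' : α < 1)
    (Z : ℕ → Ω → H) (hZ : Z = GeomMedian.iterate (GeomMedian.stepSize c α) Z₁ Xs) :
    (∀ n, 1 ≤ n → Integrable (fun ω => ‖Z n ω - m‖ ^ 2) μ) ∧
    (∀ n, 1 ≤ n → Integrable (fun ω => ‖Z n ω - m‖ ^ 4) μ) ∧
    Tendsto (fun n : ℕ => ∫ ω, ‖Z n ω - m‖ ^ 2 ∂μ) atTop (𝓝 0) ∧
    (fun n : ℕ => ∫ ω, ‖Z n ω - m‖ ^ 2 ∂μ) =O[atTop] (fun n : ℕ => (n : ℝ) ^ (-α)) ∧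
    ∀ β : ℝ, α < β → β < 3 * α - 1 →
      (fun n : ℕ => ∫ ω, ‖Z n ω - m‖ ^ 4 ∂μ) =O[atTop] (fun n : ℕ => (n : ℝ) ^ (-β)) := by
  have : SecondCountableTopology H := UniformSpace.secondCountable_of_separable H
  obtain ⟨κ, hκ, hgrowth⟩ := hm.exists_growth hX hA1 hA2
  have h := GeomMedian.isContractive_iterate hgrowth hXs hident hindep hZ₁ hbdd hZ₁indep
    (GeomMedian.stepSize_nonneg (α := α) hc.le)
  rw [← hZ] at h
  have hO : ∀ {k : ℕ} {β : ℝ},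
      (∃ K : ℝ, 0 ≤ K ∧ ∀ n : ℕ, 1 ≤ n → ∫ ω, ‖Z n ω - m‖ ^ k ∂μ ≤ K * (n : ℝ) ^ (-β)) →
      (fun n : ℕ => ∫ ω, ‖Z n ω - m‖ ^ k ∂μ) =O[atTop] (fun n : ℕ => (n : ℝ) ^ (-β)) := by
    rintro k β ⟨K, -, hK⟩
    refine IsBigO.of_bound K ?_
    filter_upwards [eventually_ge_atTop 1] with n hn
    rw [Real.norm_of_nonneg (integral_nonneg fun ω => by positivity),
      Real.norm_of_nonneg (by positivity)]
    exact hK n hn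
  have hsq := hO (h.exists_integral_sq_le hκ hc hα hα')
  refine ⟨fun n hn => h.integrable_comp hn (ψ := fun x => x ^ 2) (by fun_prop),
    fun n hn => h.integrable_comp hn (ψ := fun x => x ^ 4) (by fun_prop),
    hsq.trans_tendsto ?_, hsq, fun β hβ hβ' =>
      -- `3 * α - 1 < 2 * α` because `α < 1`.
      hO (h.exists_integral_pow_four_le hκ hc hα hα' (by linarith))⟩
  exact (tendsto_rpow_neg_atTop (by linarith)).comp tendsto_natCast_atTop_atTop
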